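/- Dual-pivot quicksort "Clairvoyant" sorts a sequence $(a_1,\dots,a_n)$ of distinct elements of a linearly ordered set as follows. If $n\le 1$, it does nothing. Otherwise it determines $p=\min(a_1,a_n)$ and $q=\max(a_1,a_n)$ by one comparison. Each of the remaining $n-2$ elements is then classified as small ($<p$), medium (between $p$ and $q$) or large ($>q$), one element per round. An oracle tells, without any comparison, the total numbers $s$ of small and $\ell$ of large elements. If $s_t$ and $\ell_t$ denote the numbers of small and large elements found in the first $t$ rounds, then the element classified in round $t+1$ is compared with $p$ first if $s-s_t\ge \ell-\ell_t$, and with $q$ first otherwise; a second comparison, with the other pivot, is made only if the first one does not determine the class. Finally the algorithm is applied recursively to the small, the medium and the large elements. The order in which the elements are classified and the arrangement of each class for its recursive call may be organized in any fixed way that depends only on the oracle's numbers and on the outcomes (classes found) of the classification rounds. Let $\mathbb E[C^{\mathrm{cv}}_n]$ be the average number of comparisons between elements made by this algorithm on $n$ distinct elements, taken over all $n!$ input orders, each with probability $1/n!$. Let $H_n=\sum_{m=1}^n \frac1m$ and $H^{\mathrm{alt}}_n=\sum_{m=1}^n\frac{(-1)^m}{m}$, and let $[A]$ be $1$ if $A$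 is true and $0$ otherwise. Then for every $n\ge 4$ $$\mathbb E[C^{\mathrm{cv}}_n]=\frac95 nH_n+\frac15 nH^{\mathrm{alt}}_n-\frac{89}{25}n+\frac{77}{40}H_n+\frac3{40}H^{\mathrm{alt}}_n+\frac{67}{800}-\frac{(-1)^n}{10}+\frac{[n\text{ even}]}{320}\Bigl(\frac1{n-3}+\frac3{n-1}\Bigr)-\frac{[n\text{ odd}]}{320}\Bigl(\frac3{n-2}+\frac1n\Bigr).$$ -/

import Mathlib

namespace DualPivot

/-- The three classes of non-pivot elements relative to pivots `p < q`. -/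
inductive Cls
  | small
  | medium
  | large
  deriving DecidableEq

section Classify

variable {α : Type*} [LinearOrder α]

/-- Classify `x` by comparing with the smaller pivot `p` first.
Returns the class and the number of comparisons made. -/
def classifyPFirst (p q x : α) : Cls × ℕ :=
  if x < p then (Cls.small, 1)
  else if x < q then (Cls.medium, 2)
  else (Cls.large, 2)

/-- Classify `x` by comparing with the larger pivot `q` first.
Returns the class and the number of comparisons made. -/
def classifyQFirst (p q x : α) : Cls × ℕ :=
  if q < x then (Cls.large, 1)
  else if x < p then (Cls.small, 2)
  else (Cls.medium, 2)

/-- Strategy "Clairvoyant" for one classification round. The numbers `s`, `l` are the total numbers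
of small and large elements (told by the oracle), `hist` is the list of classes found in the
previous rounds, so that `hist.count Cls.small` is `s_t` and `hist.count Cls.large` is `l_t`. -/
def classifyClairvoyant (p q : α) (s l : ℕ) (hist : List Cls) (x : α) : Cls × ℕ :=
  if (s : ℤ) - hist.count Cls.small ≥ (l : ℤ) - hist.count Cls.large
  then classifyPFirst p q x
  else classifyQFirst p q x

end Classify

/-- The organizational details of a partitioning procedure that cost no comparison: which element is
classified next, and how the classified elements are arranged for the recursive calls. They may
depend on nothing but the outcomes of the classification rounds and the oracle's answer. -/
structure Layout where
  /-- `pick s l hist r` is the index of the element to be classified next, among the `r + 1`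
  elements not yet classified, when the oracle's totals are `s`, `l` and the classes found so far
  are `hist`. -/
  pick : (s l : ℕ) → (hist : List Cls) → (r : ℕ) → Fin (r + 1)
  /-- `place word c k` is the rearrangement (relative to the order of classification) of the `k`
  elements of class `c` when the complete sequence of classes found is `word`. -/
  place : (word : List Cls) → (c : Cls) → (k : ℕ) → Equiv.Perm (Fin k)

section Quicksort

variable {α : Type*}

/-- The classification loop on the unclassified elements `rem`. Returns the elements in the order in
which they are classified, each with its class, and the number of comparisons. -/
def classifyLoop [LinearOrder α] (L : Layout) (p q : α) (s l : ℕ) :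
    (hist : List Cls) → (rem : List α) → List (α × Cls) × ℕ
  | _, [] => ([], 0)
  | hist, x :: xs =>
    let i : Fin (x :: xs).length := L.pick s l hist xs.length
    let y := (x :: xs).get i
    let c := classifyClairvoyant p q s l hist y
    let r := classifyLoop L p q s l (hist ++ [c.1]) ((x :: xs).eraseIdx i)
    ((y, c.1) :: r.1, c.2 + r.2)
  termination_by _ rem => rem.length
  decreasing_by
    have h := i.isLt
    simp only [List.length_cons] at h
    simp only [List.length_eraseIdx, List.length_cons]
    split <;> omega

theorem length_classifyLoop [LinearOrder α] (L : Layout) (p q : α) (s l : ℕ) (hist : List Cls) (rem : List α) :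
    (classifyLoop L p q s l hist rem).1.length = rem.length := by
  induction hist, rem using classifyLoop.induct L p q s l with
  | case1 hist => simp [classifyLoop]
  | case2 hist x xs i y c ih =>
    have h := i.isLt
    rw [classifyLoop]
    simp only [List.length_cons]
    rw [ih, List.length_eraseIdx, if_pos h, List.length_cons]
    omega

/-- The elements of class `c`, in the order in which they are handed to the recursive call. -/
def bucket (L : Layout) (out : List (α × Cls)) (c : Cls) : List α :=
  let b := (out.filter (fun y => y.2 = c)).map Prod.fst
  List.ofFn fun i : Fin b.length => b.get (L.place (out.map Prod.snd) c b.length i)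

theorem length_bucket_le (L : Layout) (out : List (α × Cls)) (c : Cls) :
    (bucket L out c).length ≤ out.length := by
  simpa [bucket] using List.length_filter_le (fun y : α × Cls => decide (y.2 = c)) out

/-- Partitioning `rem` by the pivots `p < q` with strategy "Clairvoyant". The oracle tells the
numbers of small and large elements at no cost. -/
def partition [LinearOrder α] (L : Layout) (p q : α) (rem : List α) : List (α × Cls) × ℕ :=
  classifyLoop L p q (rem.countP (fun x => x < p)) (rem.countP (fun x => q < x)) [] rem

/-- Dual-pivot quicksort "Clairvoyant" with first and last element as pivots. Returns the sorted list
and the number of comparisons between elements. -/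
def clairvoyant [LinearOrder α] (L : Layout) : List α → List α × ℕ
  | [] => ([], 0)
  | [a] => ([a], 0)
  | a :: x :: xs =>
    let b := (x :: xs).getLast (List.cons_ne_nil x xs)
    let p := min a b
    let q := max a b
    let out := partition L p q (x :: xs).dropLast
    let small := clairvoyant L (bucket L out.1 Cls.small)
    let medium := clairvoyant L (bucket L out.1 Cls.medium)
    let large := clairvoyant L (bucket L out.1 Cls.large)
    (small.1 ++ p :: medium.1 ++ q :: large.1, 1 + out.2 + small.2 + medium.2 + large.2)
  termination_by l => l.length
  decreasing_by
    all_goals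
      refine lt_of_le_of_lt (length_bucket_le L _ _) ?_
      simp [partition, length_classifyLoop]

/-- The average number of comparisons of dual-pivot quicksort "Clairvoyant" over all `n!` orders of
the elements `a 0, …, a (n - 1)`. -/
def avgComparisons [LinearOrder α] (L : Layout) {n : ℕ} (a : Fin n → α) : ℚ :=
  (∑ σ : Equiv.Perm (Fin n), ((clairvoyant L (List.ofFn (a ∘ σ))).2 : ℚ)) / n.factorial

end Quicksort

/-- The alternating harmonic number `∑_{m=1}^n (-1)^m / m`. -/
def harmonicAlt (n : ℕ) : ℚ := ∑ m ∈ Finset.Icc 1 n, (-1 : ℚ) ^ m / m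

end DualPivot

namespace DualPivot

/-! All averages are written as sums over `orders A`, the list arrangements of a finite set. They
then depend only on its cardinality, whatever the `Layout`, for three reasons.

Classification: the next index is determined by the oracle and the history alone. Hence the next
element is uniform among those left, and the others stay in uniformly random order. The mean cost
obeys the urn recursion `meanCost` in the class sizes (`sum_classifyLoop`).

Recursive calls: permuting the elements inside one class changes neither the course of the loop nor
its cost, so each class reaches its recursive call in uniformly random order (`sum_bucket`).

Pivots: the first and last elements form a uniform ordered pair, and each triple of class sizes
comes from exactly two such pairs (`sum_pivots`).

Together these give the quicksort recurrence `meanTotal` (`sum_clairvoyant`). Its toll `sumCost` is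
found without solving `meanCost`: summing the urn recursion over all triples of fixed sum gives a
first-order recurrence in that sum (`sumCost_succ`), with a closed form for each parity. Second
differences then turn the quicksort recurrence into one of order two (`meanTotal_recurrence`), and
the closed form follows by induction from the values at 4 and 5. -/

theorem sum_comp_of_injOn {ι κ M : Type*} [AddCommMonoid M] {t : Finset ι} {u : Finset κ}
    (f : ι → κ) (hf : ∀ i ∈ t, f i ∈ u) (hinj : Set.InjOn f t) (hcard : u.card ≤ t.card)
    (F : κ → M) : ∑ i ∈ t, F (f i) = ∑ x ∈ u, F x := by
  classical
  -- Injectivity and the cardinality bound force the image to be all of `u`; surjectivity never has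
  -- to be shown directly.
  rw [← Finset.sum_image hinj, Finset.eq_of_subset_of_card_le (Finset.image_subset_iff.2 hf)]
  rwa [Finset.card_image_of_injOn hinj]

/-! ### Uniformly random arrangements of a finite set -/

section Orders

variable {α : Type*} [DecidableEq α]

/-- The lists in which every element of `s` occurs exactly once and nothing else occurs. -/
noncomputable def orders (s : Finset α) : Finset (List α) :=
  s.toList.permutations.toFinset

theorem mem_orders_iff_perm {s : Finset α} {l : List α} : l ∈ orders s ↔ l.Perm s.toList := by
  simp [orders]

theorem mem_orders {s : Finset α} {l : List α} : l ∈ orders s ↔ l.Nodup ∧ l.toFinset = s := by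
  rw [mem_orders_iff_perm]
  constructor
  · intro h
    exact ⟨h.nodup_iff.2 s.nodup_toList, by rw [List.toFinset_eq_of_perm _ _ h, Finset.toList_toFinset]⟩
  · rintro ⟨h, rfl⟩
    exact (List.toFinset_toList h).symm

theorem card_orders (s : Finset α) : (orders s).card = s.card.factorial := by
  rw [orders, List.toFinset_card_of_nodup (List.nodup_permutations _ s.nodup_toList),
    List.length_permutations, Finset.length_toList]

theorem length_of_mem_orders {s : Finset α} {l : List α} (h : l ∈ orders s) :
    l.length = s.card := by
  rw [(mem_orders_iff_perm.1 h).length_eq, Finset.length_toList]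

theorem mem_of_mem_orders {s : Finset α} {l : List α} (h : l ∈ orders s) {x : α} :
    x ∈ l ↔ x ∈ s := by
  rw [(mem_orders_iff_perm.1 h).mem_iff, Finset.mem_toList]

theorem insertIdx_mem_orders {s : Finset α} {y : α} (hy : y ∈ s) {l : List α} {k : ℕ}
    (hk : k < s.card) (h : l ∈ orders (s.erase y)) : l.insertIdx k y ∈ orders s := by
  have hl := length_of_mem_orders h
  rw [Finset.card_erase_of_mem hy] at hl
  rw [mem_orders_iff_perm] at h ⊢
  refine (List.perm_insertIdx y l (by omega)).trans ((h.cons y).trans ?_)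
  have := Finset.toList_insert (Finset.notMem_erase y s)
  rw [Finset.insert_erase hy] at this
  exact this.symm

/-- Orders of `s`, sorted by the element at position `k`. -/
theorem sum_orders_insertIdx {M : Type*} [AddCommMonoid M] (s : Finset α) {k : ℕ}
    (hk : k < s.card) (F : List α → M) :
    ∑ l ∈ orders s, F l = ∑ y ∈ s, ∑ l ∈ orders (s.erase y), F (l.insertIdx k y) := by
  rw [Finset.sum_sigma']
  symm
  refine sum_comp_of_injOn (fun x : (_ : α) × List α => x.2.insertIdx k x.1) ?_ ?_ ?_ F
  · rintro ⟨y, l⟩ h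
    rw [Finset.mem_sigma] at h
    exact insertIdx_mem_orders h.1 hk h.2
  · rintro ⟨y, l⟩ h ⟨y', l'⟩ h' heq
    simp only [Finset.coe_sigma, Set.mem_sigma_iff, Finset.mem_coe] at h h' heq
    have hl := length_of_mem_orders h.2
    have hl' := length_of_mem_orders h'.2
    rw [Finset.card_erase_of_mem h.1] at hl
    rw [Finset.card_erase_of_mem h'.1] at hl'
    have h1 : l = l' := by
      rw [← List.eraseIdx_insertIdx_self (i := k) (l := l) (a := y), heq, List.eraseIdx_insertIdx_self]
    have h2 : (l.insertIdx k y)[k]? = (l'.insertIdx k y')[k]? := by rw [heq]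
    rw [List.getElem?_insertIdx_self, List.getElem?_insertIdx_self, if_pos (by omega),
      if_pos (by omega)] at h2
    simp_all
  · rw [card_orders, Finset.card_sigma, Finset.sum_congr rfl fun y hy => by
      rw [card_orders, Finset.card_erase_of_mem hy], Finset.sum_const, smul_eq_mul,
      Nat.mul_factorial_pred (by omega)]

/-- The entries of an injective `a`, rearranged by all permutations of the positions. -/
theorem sum_perm_ofFn {M : Type*} [AddCommMonoid M] {n : ℕ} (a : Fin n → α)
    (ha : Function.Injective a) (F : List α → M) :
    ∑ σ : Equiv.Perm (Fin n), F (List.ofFn (a ∘ σ)) =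
      ∑ l ∈ orders (Finset.univ.image a), F l := by
  refine sum_comp_of_injOn (fun σ : Equiv.Perm (Fin n) => List.ofFn (a ∘ σ)) ?_ ?_ ?_ F
  · intro σ _
    rw [mem_orders]
    refine ⟨List.nodup_ofFn.2 (ha.comp σ.injective), ?_⟩
    ext x
    simp only [List.mem_toFinset, List.mem_ofFn, Finset.mem_image, Finset.mem_univ,
      true_and, Function.comp_apply]
    exact (σ.surjective.exists (p := fun i => a i = x)).symm
  · intro σ _ τ _ h
    ext i
    simpa using congrArg Fin.val (ha (congrFun (List.ofFn_injective h) i))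
  · rw [card_orders, Finset.card_image_of_injective _ ha, Finset.card_univ, Finset.card_univ,
      Fintype.card_perm]

theorem map_mem_orders {s : Finset α} {l : List α} (h : l ∈ orders s) (σ : Equiv.Perm α)
    (hσ : ∀ x, σ x ∈ s ↔ x ∈ s) : l.map σ ∈ orders s := by
  rw [mem_orders] at h ⊢
  refine ⟨h.1.map σ.injective, ?_⟩
  ext x
  obtain ⟨y, rfl⟩ := σ.surjective x
  rw [hσ, ← h.2, List.mem_toFinset, List.mem_toFinset, List.mem_map_of_injective σ.injective]

/-- A list enumerating `s`, its entries renamed by all permutations of `s`. -/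
theorem sum_perm_map {M : Type*} [AddCommMonoid M] {s : Finset α} {b : List α} (hb : b ∈ orders s)
    (F : List α → M) :
    ∑ σ : Equiv.Perm s, F (b.map (Equiv.Perm.ofSubtype σ)) = ∑ l ∈ orders s, F l := by
  refine sum_comp_of_injOn (fun σ : Equiv.Perm s => b.map (Equiv.Perm.ofSubtype σ)) ?_ ?_ ?_ F
  · intro σ _
    exact map_mem_orders hb _ fun x => Equiv.Perm.ofSubtype_apply_mem_iff_mem σ x
  · intro σ _ τ _ h
    ext x
    have := List.map_inj_left.1 h x ((mem_of_mem_orders hb).2 x.2)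
    simpa using this
  · rw [card_orders, Finset.card_univ, Fintype.card_perm, Fintype.card_coe]

theorem sum_orders_map {M : Type*} [AddCommMonoid M] {s : Finset α} (σ : Equiv.Perm α)
    (hσ : ∀ x, σ x ∈ s ↔ x ∈ s) (F : List α → M) :
    ∑ l ∈ orders s, F (l.map σ) = ∑ l ∈ orders s, F l :=
  sum_comp_of_injOn (fun l : List α => l.map σ) (fun _ h => map_mem_orders h σ hσ)
    (List.map_injective_iff.2 σ.injective).injOn le_rfl F

end Orders

/-! ### Mean cost of the classification loop -/

section Loop

variable {α : Type*} [LinearOrder α]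

/-- The class of `x` relative to the pivots `p` and `q`. -/
def clsOf (p q x : α) : Cls :=
  if x < p then Cls.small else if x < q then Cls.medium else Cls.large

/-- The comparisons made to find class `c` while `s` small and `l` large elements are left. -/
def roundCost (s l : ℤ) : Cls → ℕ
  | Cls.small => if l ≤ s then 1 else 2
  | Cls.medium => 2
  | Cls.large => if l ≤ s then 2 else 1

/-- Both orders of comparison find the same class and differ only in cost. This needs `x` distinct
from `q`: at `x = q` one branch answers large, the other medium. -/
theorem classifyClairvoyant_eq {p q x : α} (hpq : p < q) (hp : x ≠ p) (hq : x ≠ q)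
    (s l : ℕ) (hist : List Cls) :
    classifyClairvoyant p q s l hist x = (clsOf p q x,
      roundCost (s - hist.count Cls.small) (l - hist.count Cls.large) (clsOf p q x)) := by
  unfold classifyClairvoyant classifyPFirst classifyQFirst clsOf
  rcases lt_or_gt_of_ne hp with h1 | h1
  · have h2 := h1.trans hpq
    simp only [if_pos h1, if_neg h2.not_gt, roundCost]
    split_ifs <;> rfl
  · rcases lt_or_gt_of_ne hq with h2 | h2
    · simp only [if_neg h1.not_gt, if_pos h2, if_neg h2.not_gt, roundCost, ite_self]
    · simp only [if_neg h1.not_gt, if_pos h2, if_neg h2.not_gt, roundCost]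
      split_ifs <;> rfl

/-- The number of elements of `R` in class `c`. -/
def clsCard (p q : α) (R : Finset α) (c : Cls) : ℕ := (R.filter fun x => clsOf p q x = c).card

theorem clsCard_erase {p q y : α} {R : Finset α} (hy : y ∈ R) (c : Cls) :
    clsCard p q (R.erase y) c = clsCard p q R c - if clsOf p q y = c then 1 else 0 := by
  unfold clsCard
  rw [Finset.filter_erase]
  split_ifs with h
  · rw [Finset.card_erase_of_mem (by simp [hy, h])]
  · rw [Finset.erase_eq_of_notMem (by simp [h]), Nat.sub_zero]

theorem clsCard_pos {p q y : α} {R : Finset α} (hy : y ∈ R) :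
    0 < clsCard p q R (clsOf p q y) :=
  Finset.card_pos.2 ⟨y, by simp [hy]⟩

theorem sum_clsOf (p q : α) (R : Finset α) (g : Cls → ℚ) :
    ∑ y ∈ R, g (clsOf p q y) = clsCard p q R Cls.small * g Cls.small +
      clsCard p q R Cls.medium * g Cls.medium + clsCard p q R Cls.large * g Cls.large := by
  induction R using Finset.induction_on with
  | empty => simp [clsCard]
  | insert a R ha ih =>
    rw [Finset.sum_insert ha, ih]
    have key : ∀ c, clsCard p q (insert a R) c =
        clsCard p q R c + if clsOf p q a = c then 1 else 0 := by
      intro c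
      unfold clsCard
      rw [Finset.filter_insert]
      split_ifs with h
      · rw [Finset.card_insert_of_notMem (by simp [ha])]
      · rfl
    rw [key, key, key]
    rcases h : clsOf p q a <;> simp <;> ring

/-- The average number of comparisons of `N` classification rounds, with `s` small, `m` medium and
`l` large elements left, when the elements come in random order. -/
def meanCost : ℕ → ℕ → ℕ → ℕ → ℚ
  | 0, _, _, _ => 0
  | N + 1, s, m, l =>
    (s + 2 * m + l + min (s : ℚ) l + s * meanCost N (s - 1) m l + m * meanCost N s (m - 1) l
      + l * meanCost N s m (l - 1)) / (N + 1)

/-- Inserting `y` at the picked index is undone by the removal in the first round, so that round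
classifies `y` and leaves exactly `rem`. -/
theorem classifyLoop_insertIdx {p q : α} (hpq : p < q) (L : Layout) (S l : ℕ) (hist : List Cls)
    (rem : List α) (y : α) (hp : y ≠ p) (hq : y ≠ q) :
    classifyLoop L p q S l hist (rem.insertIdx (L.pick S l hist rem.length) y) =
      ((y, clsOf p q y) :: (classifyLoop L p q S l (hist ++ [clsOf p q y]) rem).1,
        (classifyClairvoyant p q S l hist y).2 +
          (classifyLoop L p q S l (hist ++ [clsOf p q y]) rem).2) := by
  obtain ⟨x, xs, hx⟩ : ∃ x xs, rem.insertIdx (L.pick S l hist rem.length) y = x :: xs := by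
    apply List.exists_cons_of_ne_nil
    intro h
    have := congrArg List.length h
    rw [List.length_insertIdx_of_le_length (by have := (L.pick S l hist rem.length).isLt; omega)] at this
    simp at this
  have hlen : xs.length = rem.length := by
    have := congrArg List.length hx
    rw [List.length_insertIdx_of_le_length (by have := (L.pick S l hist rem.length).isLt; omega)] at this
    simpa using this.symm
  have hget : (x :: xs).get (L.pick S l hist xs.length) = y := by
    -- Lookup by a natural number index, because the `Fin` index of `get` has a type depending on
    -- the list and blocks rewriting.
    have : (x :: xs)[((L.pick S l hist xs.length : Fin _) : ℕ)]? = some y := by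
      rw [← hx, hlen, List.getElem?_insertIdx_self, if_pos]
      have := (L.pick S l hist rem.length).isLt
      omega
    rw [List.getElem?_eq_some_iff] at this
    exact this.2
  have hera : (x :: xs).eraseIdx (L.pick S l hist xs.length) = rem := by
    rw [← hx, hlen, List.eraseIdx_insertIdx_self]
  rw [hx, classifyLoop]
  rw [hget, hera, classifyClairvoyant_eq hpq hp hq]

/-- The pick does not look at the elements, so splitting the orders at the picked position makes the
next element uniform and the rest uniformly ordered. The equations for `S` and `l` are the loop
invariant: the oracle's total is what was found plus what is left. -/
theorem sum_classifyLoop {p q : α} (hpq : p < q) (L : Layout) (S l : ℕ) (N : ℕ) :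
    ∀ (hist : List Cls) (R : Finset α), p ∉ R → q ∉ R → R.card = N →
      S = hist.count Cls.small + clsCard p q R Cls.small →
      l = hist.count Cls.large + clsCard p q R Cls.large →
      ∑ rem ∈ orders R, ((classifyLoop L p q S l hist rem).2 : ℚ) =
        N.factorial * meanCost N (clsCard p q R Cls.small) (clsCard p q R Cls.medium)
          (clsCard p q R Cls.large) := by
  induction N with
  | zero =>
    intro hist R _ _ hR _ _
    rw [Finset.card_eq_zero] at hR
    subst hR
    rw [meanCost, mul_zero]
    refine Finset.sum_eq_zero fun rem h => ?_
    have := length_of_mem_orders h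
    rw [Finset.card_empty, List.length_eq_zero_iff] at this
    subst this
    simp [classifyLoop]
  | succ N ih =>
    intro hist R hp hq hR hS hl
    rw [sum_orders_insertIdx R (k := L.pick S l hist N)
      (by rw [hR]; exact (L.pick S l hist N).isLt)]
    set s := clsCard p q R Cls.small with hs
    set m := clsCard p q R Cls.medium with hm
    set e := clsCard p q R Cls.large with he
    let g : Cls → ℚ := fun c => N.factorial * (roundCost s e c +
      meanCost N (s - if c = Cls.small then 1 else 0) (m - if c = Cls.medium then 1 else 0)
        (e - if c = Cls.large then 1 else 0))
    have hS' : (S : ℤ) - hist.count Cls.small = s := by omega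
    have hl' : (l : ℤ) - hist.count Cls.large = e := by omega
    have key : ∀ y ∈ R, ∑ rem ∈ orders (R.erase y),
        ((classifyLoop L p q S l hist (rem.insertIdx (L.pick S l hist N) y)).2 : ℚ) =
        g (clsOf p q y) := by
      intro y hy
      have hyp : y ≠ p := fun h => hp (h ▸ hy)
      have hyq : y ≠ q := fun h => hq (h ▸ hy)
      have hc : (R.erase y).card = N := by rw [Finset.card_erase_of_mem hy, hR]; rfl
      have step : ∀ rem ∈ orders (R.erase y),
          ((classifyLoop L p q S l hist (rem.insertIdx (L.pick S l hist N) y)).2 : ℚ) =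
          roundCost s e (clsOf p q y) +
            ((classifyLoop L p q S l (hist ++ [clsOf p q y]) rem).2 : ℚ) := by
        intro rem hrem
        have hlen : rem.length = N := (length_of_mem_orders hrem).trans hc
        have := classifyLoop_insertIdx hpq L S l hist rem y hyp hyq
        rw [hlen] at this
        rw [this, classifyClairvoyant_eq hpq hyp hyq, hS', hl']
        push_cast
        rfl
      rw [Finset.sum_congr rfl step, Finset.sum_add_distrib, Finset.sum_const, card_orders, hc,
        nsmul_eq_mul]
      have hpos := clsCard_pos (p := p) (q := q) hy
      rw [ih (hist ++ [clsOf p q y]) (R.erase y) (fun h => hp (Finset.mem_of_mem_erase h))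
        (fun h => hq (Finset.mem_of_mem_erase h)) hc, clsCard_erase hy, clsCard_erase hy,
        clsCard_erase hy]
      · simp only [g]; ring
      -- The invariant survives the round; `hpos` excludes truncation when the class of `y` loses an
      -- element.
      · rw [clsCard_erase hy, List.count_append, ← hs, hS]
        rcases h : clsOf p q y <;> rw [h] at hpos <;> simp <;> try omega
      · rw [clsCard_erase hy, List.count_append, ← he, hl]
        rcases h : clsOf p q y <;> rw [h] at hpos <;> simp <;> try omega
    rw [Finset.sum_congr rfl key, sum_clsOf, ← hs, ← hm, ← he, meanCost, Nat.factorial_succ]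
    have hN : (N : ℚ) + 1 ≠ 0 := by positivity
    simp only [g, roundCost]
    -- Medium elements always cost 2, and the rarer of the two outer classes also costs 2. This
    -- surcharge on the rarer class is the term `min s l` in `meanCost`.
    by_cases h : e ≤ s
    · have h' : (e : ℚ) ≤ s := by exact_mod_cast h
      rw [min_eq_right h']
      simp [h]
      field_simp
      ring
    · have h' : (s : ℚ) ≤ e := by exact_mod_cast (not_le.1 h).le
      rw [min_eq_left h']
      simp [h]
      field_simp
      ring

end Loop

/-! ### Randomness is preserved in the recursive calls -/

section Bucket

variable {α : Type*}

theorem bucket_perm (L : Layout) (out : List (α × Cls)) (c : Cls) :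
    (bucket L out c).Perm ((out.filter (fun y => y.2 = c)).map Prod.fst) := by
  unfold bucket
  refine (Equiv.Perm.ofFn_comp_perm _ _).trans ?_
  simp

/-- `place` sees only the word of classes and the size of the bucket, and renaming elements alters
neither. -/
theorem bucket_map (L : Layout) (out : List (α × Cls)) (c : Cls) (σ : α → α) :
    bucket L (out.map (Prod.map σ id)) c = (bucket L out c).map σ := by
  have hf : ((out.map (Prod.map σ id)).filter (fun y => y.2 = c)).map Prod.fst =
      ((out.filter (fun y => y.2 = c)).map Prod.fst).map σ := by
    rw [List.filter_map, List.map_map, List.map_map]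
    rfl
  have hw : (out.map (Prod.map σ id)).map Prod.snd = out.map Prod.snd := by
    rw [List.map_map]
    rfl
  -- Stated for arbitrary equal data, so that substitution can act where rewriting under the
  -- dependent type `Fin b.length` would fail.
  have key : ∀ (w w' : List Cls) (b b' : List α), w' = w → b' = b.map σ →
      (List.ofFn fun i : Fin b'.length => b'.get (L.place w' c b'.length i)) =
      (List.ofFn fun i : Fin b.length => b.get (L.place w c b.length i)).map σ := by
    rintro _ w b _ rfl rfl
    have hlen : (b.map σ).length = b.length := List.length_map _
    rw [List.map_ofFn]
    apply List.ext_getElem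
    · simp
    · intro n h1 h2
      simp only [List.getElem_ofFn, List.get_eq_getElem, List.getElem_map, Function.comp_apply]
      congr 2
      have : ∀ k (hk : k = b.length) (h : n < k) (h' : n < b.length),
          (L.place w c k ⟨n, h⟩ : ℕ) = L.place w c b.length ⟨n, h'⟩ := by
        rintro k rfl h h'
        rfl
      exact this _ hlen _ _
  exact key _ _ _ _ hw hf

variable [LinearOrder α]

theorem classifyLoop_perm {p q : α} (hpq : p < q) (L : Layout) (s l : ℕ) (hist : List Cls)
    (rem : List α) (hp : p ∉ rem) (hq : q ∉ rem) :
    (classifyLoop L p q s l hist rem).1.Perm (rem.map fun x => (x, clsOf p q x)) := by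
  induction hist, rem using classifyLoop.induct L p q s l with
  | case1 hist => simp [classifyLoop]
  | case2 hist x xs i y c ih =>
    have hy : y ∈ x :: xs := List.get_mem _ _
    have hc : c.1 = clsOf p q y :=
      congrArg Prod.fst <|
        classifyClairvoyant_eq hpq (fun h => hp (h ▸ hy)) (fun h => hq (h ▸ hy)) s l hist
    have hsub : (x :: xs).eraseIdx i ⊆ x :: xs := (List.eraseIdx_sublist _ _).subset
    have := ih (fun h => hp (hsub h)) (fun h => hq (hsub h))
    rw [classifyLoop]
    refine (this.cons (y, c.1)).trans ?_
    rw [hc]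
    have h2 : (y :: (x :: xs).eraseIdx i).Perm (x :: xs) :=
      List.getElem_cons_eraseIdx_perm i.isLt
    exact h2.map fun x => (x, clsOf p q x)

theorem bucket_mem_orders {p q : α} (hpq : p < q) (L : Layout) (s l : ℕ) (R : Finset α)
    (hp : p ∉ R) (hq : q ∉ R) (c : Cls) {rem : List α} (h : rem ∈ orders R) :
    bucket L (classifyLoop L p q s l [] rem).1 c ∈ orders (R.filter fun x => clsOf p q x = c) := by
  have h1 := classifyLoop_perm hpq L s l [] rem (fun h' => hp ((mem_of_mem_orders h).1 h'))
    (fun h' => hq ((mem_of_mem_orders h).1 h'))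
  have h2 : (bucket L (classifyLoop L p q s l [] rem).1 c).Perm
      (rem.filter fun x => clsOf p q x = c) := by
    refine (bucket_perm _ _ _).trans (((h1.filter _).map _).trans ?_)
    rw [List.filter_map, List.map_map]
    simp [Function.comp_def]
  rw [mem_orders] at h ⊢
  refine ⟨h2.nodup_iff.2 (h.1.filter _), ?_⟩
  rw [List.toFinset_eq_of_perm _ _ h2, List.toFinset_filter, h.2]
  simp

/-- Renaming the elements within their classes commutes with the classification loop. -/
theorem classifyLoop_map {p q : α} (L : Layout) (s l : ℕ) (σ : α → α) (hist : List Cls)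
    (rem : List α)
    (hσ : ∀ x ∈ rem, ∀ h, classifyClairvoyant p q s l h (σ x) = classifyClairvoyant p q s l h x) :
    classifyLoop L p q s l hist (rem.map σ) =
      ((classifyLoop L p q s l hist rem).1.map (Prod.map σ id),
        (classifyLoop L p q s l hist rem).2) := by
  induction hist, rem using classifyLoop.induct L p q s l with
  | case1 hist => simp [classifyLoop]
  | case2 hist x xs i y c ih =>
    have hsub : (x :: xs).eraseIdx i ⊆ x :: xs := (List.eraseIdx_sublist _ _).subset
    have hy : y ∈ x :: xs := List.get_mem _ _
    have ih' := ih fun z hz => hσ z (hsub hz)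
    have hlen : (xs.map σ).length = xs.length := List.length_map _
    have hget : (σ x :: xs.map σ).get (L.pick s l hist (xs.map σ).length) = σ y := by
      have : (σ x :: xs.map σ)[((L.pick s l hist (xs.map σ).length : Fin _) : ℕ)]? = some (σ y) := by
        rw [hlen, ← List.map_cons, List.getElem?_map]
        have hi : (x :: xs)[((L.pick s l hist xs.length : Fin _) : ℕ)]? = some y := by
          rw [List.getElem?_eq_some_iff]
          exact ⟨i.isLt, rfl⟩
        rw [hi]
        rfl
      rw [List.getElem?_eq_some_iff] at this
      exact this.2
    have hera : (σ x :: xs.map σ).eraseIdx (L.pick s l hist (xs.map σ).length) =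
        ((x :: xs).eraseIdx i).map σ := by
      rw [hlen, ← List.map_cons, List.eraseIdx_map]
    rw [List.map_cons, classifyLoop, hget, hera, hσ y hy hist, ih', classifyLoop]
    rfl

/-- Average over the permutations of class `c`, extended by the identity. They preserve `orders R`,
and they act on the bucket by renaming. For each fixed `rem` the renamed bucket runs once through
all orders of the class. Both factorials stay as factors to avoid division. -/
theorem sum_bucket {p q : α} (hpq : p < q) (L : Layout) (s l : ℕ) (R : Finset α)
    (hp : p ∉ R) (hq : q ∉ R) (c : Cls) (T : List α → ℚ) :
    (clsCard p q R c).factorial *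
        ∑ rem ∈ orders R, T (bucket L (classifyLoop L p q s l [] rem).1 c) =
      R.card.factorial * ∑ b ∈ orders (R.filter fun x => clsOf p q x = c), T b := by
  set B := R.filter fun x => clsOf p q x = c with hB
  have hfix : ∀ (σ : Equiv.Perm B) (x : α), Equiv.Perm.ofSubtype σ x ∈ R ↔ x ∈ R := by
    intro σ x
    by_cases hx : x ∈ B
    · have := (Equiv.Perm.ofSubtype_apply_mem_iff_mem σ x).2 hx
      exact iff_of_true (Finset.mem_of_mem_filter _ this) (Finset.mem_of_mem_filter _ hx)
    · rw [Equiv.Perm.ofSubtype_apply_of_not_mem σ hx]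
  have hcls : ∀ (σ : Equiv.Perm B), ∀ x ∈ R, ∀ h : List Cls,
      classifyClairvoyant p q s l h (Equiv.Perm.ofSubtype σ x) =
        classifyClairvoyant p q s l h x := by
    intro σ x hx h
    by_cases hxB : x ∈ B
    · have h1 := (Equiv.Perm.ofSubtype_apply_mem_iff_mem σ x).2 hxB
      set y := Equiv.Perm.ofSubtype σ x
      have hyR : y ∈ R := Finset.mem_of_mem_filter _ h1
      have hyc : clsOf p q y = clsOf p q x := by
        rw [(Finset.mem_filter.1 h1).2, (Finset.mem_filter.1 hxB).2]
      have e1 := fun z (hz : z ∈ R) => classifyClairvoyant_eq hpq (x := z)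
        (fun h => hp (h ▸ hz)) (fun h => hq (h ▸ hz)) s l h
      rw [e1 y hyR, e1 x hx, hyc]
    · rw [Equiv.Perm.ofSubtype_apply_of_not_mem σ hxB]
  calc ((clsCard p q R c).factorial : ℚ) *
        ∑ rem ∈ orders R, T (bucket L (classifyLoop L p q s l [] rem).1 c)
      = ∑ σ : Equiv.Perm B, ∑ rem ∈ orders R,
          T (bucket L (classifyLoop L p q s l [] (rem.map (Equiv.Perm.ofSubtype σ))).1 c) := by
        rw [Finset.sum_congr rfl fun σ _ => sum_orders_map (Equiv.Perm.ofSubtype σ) (hfix σ)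
          fun rem => T (bucket L (classifyLoop L p q s l [] rem).1 c), Finset.sum_const,
          Finset.card_univ, Fintype.card_perm, Fintype.card_coe, nsmul_eq_mul]
        rfl
    _ = ∑ σ : Equiv.Perm B, ∑ rem ∈ orders R,
          T ((bucket L (classifyLoop L p q s l [] rem).1 c).map (Equiv.Perm.ofSubtype σ)) := by
        refine Finset.sum_congr rfl fun σ _ => Finset.sum_congr rfl fun rem hrem => ?_
        rw [classifyLoop_map L s l _ [] rem fun x hx => hcls σ x ((mem_of_mem_orders hrem).1 hx),
          bucket_map]
    _ = ∑ rem ∈ orders R, ∑ b ∈ orders B, T b := by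
        rw [Finset.sum_comm]
        refine Finset.sum_congr rfl fun rem hrem => ?_
        exact sum_perm_map (bucket_mem_orders hpq L s l R hp hq c hrem) T
    _ = _ := by rw [Finset.sum_const, card_orders, nsmul_eq_mul]

end Bucket

/-! ### Sums over triples of class sizes -/

/-- The triples of natural numbers with sum `N`. -/
def triples (N : ℕ) : Finset (ℕ × ℕ × ℕ) :=
  (Finset.range (N + 1) ×ˢ Finset.range (N + 1) ×ˢ Finset.range (N + 1)).filter
    fun t => t.1 + t.2.1 + t.2.2 = N

theorem mem_triples {N : ℕ} {t : ℕ × ℕ × ℕ} : t ∈ triples N ↔ t.1 + t.2.1 + t.2.2 = N := by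
  simp only [triples, Finset.mem_filter, Finset.mem_product, Finset.mem_range]
  omega

theorem sum_triples (N : ℕ) (F : ℕ → ℕ → ℕ → ℚ) :
    ∑ t ∈ triples N, F t.1 t.2.1 t.2.2 =
      ∑ s ∈ Finset.range (N + 1), ∑ m ∈ Finset.range (N + 1 - s), F s m (N - s - m) := by
  rw [Finset.sum_sigma']
  refine Finset.sum_nbij' (fun t => ⟨t.1, t.2.1⟩) (fun x => (x.1, x.2, N - x.1 - x.2)) ?_ ?_ ?_ ?_ ?_
  · intro t ht
    rw [mem_triples] at ht
    simp only [Finset.mem_sigma, Finset.mem_range]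
    omega
  · rintro ⟨s, m⟩ h
    simp only [Finset.mem_sigma, Finset.mem_range] at h
    rw [mem_triples]
    simp only
    omega
  · rintro ⟨s, m, l⟩ ht
    rw [mem_triples] at ht
    simp only [Prod.mk.injEq, true_and] at ht ⊢
    omega
  · intro x _
    rfl
  · rintro ⟨s, m, l⟩ ht
    rw [mem_triples] at ht
    simp only at ht ⊢
    congr 1
    omega

theorem sum_triples_fst (N : ℕ) (h : ℕ → ℚ) :
    ∑ t ∈ triples N, h t.1 = ∑ k ∈ Finset.range (N + 1), ((N : ℚ) + 1 - k) * h k := by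
  rw [sum_triples N fun s _ _ => h s]
  refine Finset.sum_congr rfl fun k hk => ?_
  rw [Finset.mem_range] at hk
  rw [Finset.sum_const, Finset.card_range, nsmul_eq_mul, Nat.cast_sub hk.le]
  push_cast
  rfl

theorem sum_triples_swap (N : ℕ) (F : ℕ → ℕ → ℕ → ℚ) :
    ∑ t ∈ triples N, F t.1 t.2.1 t.2.2 = ∑ t ∈ triples N, F t.2.1 t.1 t.2.2 := by
  refine Finset.sum_nbij' (fun t => (t.2.1, t.1, t.2.2)) (fun t => (t.2.1, t.1, t.2.2)) ?_ ?_ ?_ ?_ ?_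
  · intro t ht
    rw [mem_triples] at ht ⊢
    simp only
    omega
  · intro t ht
    rw [mem_triples] at ht ⊢
    simp only
    omega
  · exact fun _ _ => rfl
  · exact fun _ _ => rfl
  · exact fun _ _ => rfl

theorem sum_triples_reverse (N : ℕ) (F : ℕ → ℕ → ℕ → ℚ) :
    ∑ t ∈ triples N, F t.1 t.2.1 t.2.2 = ∑ t ∈ triples N, F t.2.2 t.2.1 t.1 := by
  refine Finset.sum_nbij' (fun t => (t.2.2, t.2.1, t.1)) (fun t => (t.2.2, t.2.1, t.1)) ?_ ?_ ?_ ?_ ?_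
  · intro t ht
    rw [mem_triples] at ht ⊢
    simp only
    omega
  · intro t ht
    rw [mem_triples] at ht ⊢
    simp only
    omega
  · exact fun _ _ => rfl
  · exact fun _ _ => rfl
  · exact fun _ _ => rfl

/-- The positions `i < j` of the pivots correspond to the triple `(i, j - i - 1, n + 1 - j)`; the
factor 2 counts the two orders of the pair. -/
theorem sum_offDiag_range (n : ℕ) (g : ℕ → ℕ → ℕ → ℚ) :
    ∑ x ∈ (Finset.range (n + 2)).offDiag,
        g (min x.1 x.2) (max x.1 x.2 - min x.1 x.2 - 1) (n + 1 - max x.1 x.2) =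
      2 * ∑ t ∈ triples n, g t.1 t.2.1 t.2.2 := by
  rw [← Finset.sum_filter_add_sum_filter_not _ (fun x : ℕ × ℕ => x.1 < x.2), two_mul]
  congr 1
  · refine Finset.sum_nbij' (fun x => (x.1, x.2 - x.1 - 1, n + 1 - x.2))
      (fun t => (t.1, t.1 + t.2.1 + 1)) ?_ ?_ ?_ ?_ ?_
    · intro x hx
      simp only [Finset.mem_filter, Finset.mem_offDiag, Finset.mem_range] at hx
      rw [mem_triples]
      simp only
      omega
    · intro t ht
      rw [mem_triples] at ht
      simp only [Finset.mem_filter, Finset.mem_offDiag, Finset.mem_range]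
      omega
    · rintro ⟨i, j⟩ hx
      simp only [Finset.mem_filter, Finset.mem_offDiag, Finset.mem_range, Prod.mk.injEq,
        true_and] at hx ⊢
      omega
    · rintro ⟨s, m, l⟩ ht
      rw [mem_triples] at ht
      simp only [Prod.mk.injEq, true_and] at ht ⊢
      omega
    · intro x hx
      rw [Finset.mem_filter] at hx
      rw [min_eq_left hx.2.le, max_eq_right hx.2.le]
  · refine Finset.sum_nbij' (fun x => (x.2, x.1 - x.2 - 1, n + 1 - x.1))
      (fun t => (t.1 + t.2.1 + 1, t.1)) ?_ ?_ ?_ ?_ ?_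
    · intro x hx
      simp only [Finset.mem_filter, Finset.mem_offDiag, Finset.mem_range] at hx
      rw [mem_triples]
      simp only
      omega
    · intro t ht
      rw [mem_triples] at ht
      simp only [Finset.mem_filter, Finset.mem_offDiag, Finset.mem_range]
      omega
    · rintro ⟨i, j⟩ hx
      simp only [Finset.mem_filter, Finset.mem_offDiag, Finset.mem_range, Prod.mk.injEq,
        and_true] at hx ⊢
      omega
    · rintro ⟨s, m, l⟩ ht
      rw [mem_triples] at ht
      simp only [Prod.mk.injEq, true_and] at ht ⊢
      omega
    · intro x hx
      rw [Finset.mem_filter, not_lt] at hx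
      rw [min_eq_right hx.2, max_eq_left hx.2]

/-! ### Class sizes in terms of the ranks of the pivots -/

section Rank

variable {α : Type*} [LinearOrder α]

/-- The number of elements of `A` below `x`. -/
def rank (A : Finset α) (x : α) : ℕ := (A.filter (· < x)).card

theorem rank_lt_rank {A : Finset α} {x y : α} (hx : x ∈ A) (h : x < y) : rank A x < rank A y := by
  refine Finset.card_lt_card (Finset.ssubset_iff_of_subset ?_ |>.2 ⟨x, ?_, ?_⟩)
  · intro z hz
    rw [Finset.mem_filter] at hz ⊢
    exact ⟨hz.1, hz.2.trans h⟩
  · simp [hx, h]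
  · simp

theorem rank_injOn (A : Finset α) : Set.InjOn (rank A) A := by
  intro x hx y hy h
  rcases lt_trichotomy x y with h' | h' | h'
  · exact absurd h (rank_lt_rank hx h').ne
  · exact h'
  · exact absurd h (rank_lt_rank hy h').ne'

theorem rank_lt_card {A : Finset α} {x : α} (hx : x ∈ A) : rank A x < A.card :=
  Finset.card_lt_card (Finset.filter_ssubset.2 ⟨x, hx, lt_irrefl x⟩)

theorem sum_offDiag_rank (A : Finset α) (G : ℕ × ℕ → ℚ) :
    ∑ x ∈ A.offDiag, G (rank A x.1, rank A x.2) = ∑ x ∈ (Finset.range A.card).offDiag, G x := by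
  refine sum_comp_of_injOn (fun x : α × α => (rank A x.1, rank A x.2)) ?_ ?_ ?_ G
  · intro x hx
    rw [Finset.mem_offDiag] at hx ⊢
    exact ⟨Finset.mem_range.2 (rank_lt_card hx.1), Finset.mem_range.2 (rank_lt_card hx.2.1),
      fun h => hx.2.2 (rank_injOn A hx.1 hx.2.1 h)⟩
  · rintro x hx y hy h
    rw [Finset.mem_coe, Finset.mem_offDiag] at hx hy
    rw [Prod.mk.injEq] at h
    exact Prod.ext (rank_injOn A hx.1 hy.1 h.1) (rank_injOn A hx.2.1 hy.2.1 h.2)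
  · rw [Finset.offDiag_card, Finset.offDiag_card, Finset.card_range]

theorem clsCard_small {A : Finset α} {p q : α} (hpq : p < q) :
    clsCard p q ((A.erase p).erase q) Cls.small = rank A p := by
  unfold clsCard rank
  congr 1
  ext x
  simp only [Finset.mem_filter, Finset.mem_erase]
  unfold clsOf
  constructor
  · rintro ⟨⟨h1, h2, h3⟩, h⟩
    refine ⟨h3, ?_⟩
    by_contra h4
    rw [if_neg h4] at h
    split_ifs at h
  · rintro ⟨h1, h2⟩
    exact ⟨⟨(h2.trans hpq).ne, h2.ne, h1⟩, if_pos h2⟩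

theorem clsCard_large {A : Finset α} {p q : α} (hpq : p < q) (hq : q ∈ A) :
    clsCard p q ((A.erase p).erase q) Cls.large = A.card - 1 - rank A q := by
  have h1 : (A.erase q).card = A.card - 1 := Finset.card_erase_of_mem hq
  have h2 := Finset.card_filter_add_card_filter_not (s := A.erase q) (· < q)
  have h3 : (A.erase q).filter (· < q) = A.filter (· < q) := by
    ext x
    simp only [Finset.mem_filter, Finset.mem_erase]
    exact ⟨fun h => ⟨h.1.2, h.2⟩, fun h => ⟨⟨h.2.ne, h.1⟩, h.2⟩⟩
  have h4 : clsCard p q ((A.erase p).erase q) Cls.large =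
      ((A.erase q).filter fun x => ¬ x < q).card := by
    unfold clsCard
    congr 1
    ext x
    simp only [Finset.mem_filter, Finset.mem_erase]
    unfold clsOf
    constructor
    · rintro ⟨⟨h1, h2, h3⟩, h⟩
      refine ⟨⟨h1, h3⟩, fun h4 => ?_⟩
      rw [if_pos h4] at h
      split_ifs at h
    · rintro ⟨⟨h1, h2⟩, h3⟩
      have h5 : p < x := hpq.trans_le (not_lt.1 h3)
      exact ⟨⟨h1, h5.ne', h2⟩, by rw [if_neg h5.not_gt, if_neg h3]⟩
  rw [h3] at h2
  unfold rank
  omega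

theorem clsCard_sum (p q : α) (R : Finset α) :
    clsCard p q R Cls.small + clsCard p q R Cls.medium + clsCard p q R Cls.large = R.card := by
  have := sum_clsOf p q R fun _ => 1
  simp only [Finset.sum_const, nsmul_eq_mul, mul_one] at this
  exact_mod_cast this.symm

/-- The class sizes for a random pair of pivots are a random triple. -/
theorem sum_pivots (n : ℕ) (A : Finset α) (hA : A.card = n + 2) (g : ℕ → ℕ → ℕ → ℚ) :
    ∑ a ∈ A, ∑ b ∈ A.erase a,
        g (clsCard (min a b) (max a b) ((A.erase a).erase b) Cls.small)
          (clsCard (min a b) (max a b) ((A.erase a).erase b) Cls.medium)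
          (clsCard (min a b) (max a b) ((A.erase a).erase b) Cls.large) =
      2 * ∑ t ∈ triples n, g t.1 t.2.1 t.2.2 := by
  rw [← sum_offDiag_range, ← hA, ← sum_offDiag_rank A fun x =>
    g (min x.1 x.2) (max x.1 x.2 - min x.1 x.2 - 1) (n + 1 - max x.1 x.2), Finset.sum_sigma']
  have key : ∀ p q : α, p ∈ A → q ∈ A → p < q →
      clsCard p q ((A.erase p).erase q) Cls.small = rank A p ∧
      clsCard p q ((A.erase p).erase q) Cls.medium = rank A q - rank A p - 1 ∧
      clsCard p q ((A.erase p).erase q) Cls.large = n + 1 - rank A q := by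
    intro p q hp hq hpq
    have h1 := clsCard_small (A := A) hpq
    have h2 := clsCard_large hpq hq
    have h3 := clsCard_sum p q ((A.erase p).erase q)
    have h4 := rank_lt_rank hp hpq
    have h5 := rank_lt_card hq
    rw [Finset.card_erase_of_mem (Finset.mem_erase.2 ⟨hpq.ne', hq⟩), Finset.card_erase_of_mem hp] at h3
    omega
  refine Finset.sum_nbij' (fun x => (x.1, x.2)) (fun x => ⟨x.1, x.2⟩) ?_ ?_ ?_ ?_ ?_
  · rintro ⟨a, b⟩ h
    simp only [Finset.mem_sigma, Finset.mem_erase, Finset.mem_offDiag] at h ⊢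
    exact ⟨h.1, h.2.2, Ne.symm h.2.1⟩
  · rintro ⟨a, b⟩ h
    simp only [Finset.mem_sigma, Finset.mem_erase, Finset.mem_offDiag] at h ⊢
    exact ⟨h.1, Ne.symm h.2.2, h.2.1⟩
  · exact fun _ _ => rfl
  · exact fun _ _ => rfl
  · rintro ⟨a, b⟩ h
    simp only [Finset.mem_sigma, Finset.mem_erase] at h ⊢
    rcases lt_or_gt_of_ne h.2.1 with h' | h'
    · obtain ⟨h1, h2, h3⟩ := key b a h.2.2 h.1 h'
      have h4 := rank_lt_rank h.2.2 h'
      rw [min_eq_right h'.le, max_eq_left h'.le, min_eq_right h4.le, max_eq_left h4.le,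
        Finset.erase_right_comm, h1, h2, h3]
    · obtain ⟨h1, h2, h3⟩ := key a b h.1 h.2.2 h'
      have h4 := rank_lt_rank h.1 h'
      rw [min_eq_left h'.le, max_eq_right h'.le, min_eq_left h4.le, max_eq_right h4.le, h1, h2, h3]

end Rank

/-! ### The quicksort recurrence -/

/-- The sum of the average partitioning costs over all class sizes with `N` non-pivot elements. -/
def sumCost (N : ℕ) : ℚ := ∑ t ∈ triples N, meanCost N t.1 t.2.1 t.2.2

/-- The average number of comparisons of dual-pivot quicksort on `n` elements. -/
def meanTotal (n : ℕ) : ℚ :=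
  if n < 2 then 0 else
    1 + 2 * sumCost (n - 2) / (n * (n - 1)) +
      6 / (n * (n - 1)) * ∑ k : Fin n, ((n : ℚ) - 1 - k) * meanTotal k
  termination_by n
  decreasing_by exact k.isLt

theorem meanTotal_of_lt_two {n : ℕ} (h : n < 2) : meanTotal n = 0 := by
  rw [meanTotal, if_pos h]

theorem meanTotal_add_two (n : ℕ) :
    ((n : ℚ) + 2) * (n + 1) * meanTotal (n + 2) = (n + 2) * (n + 1) + 2 * sumCost n +
      6 * ∑ k ∈ Finset.range (n + 1), ((n : ℚ) + 1 - k) * meanTotal k := by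
  -- The definition also sums over `k = n + 1`, where the weight is 0.
  have h : ∑ k ∈ Finset.range (n + 1), ((n : ℚ) + 1 - k) * meanTotal k =
      ∑ k : Fin (n + 2), (((n + 2 : ℕ) : ℚ) - 1 - (k : ℕ)) * meanTotal k := by
    rw [Fin.sum_univ_eq_sum_range (fun k => (((n + 2 : ℕ) : ℚ) - 1 - k) * meanTotal k) (n + 2),
      Finset.sum_range_succ _ (n + 1)]
    push_cast
    have e : ∀ k : ℚ, (n : ℚ) + 2 - 1 - k = n + 1 - k := fun k => by ring
    simp [e]
  rw [h, meanTotal, if_neg (by omega), Nat.add_sub_cancel]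
  have h1 : ((n + 2 : ℕ) : ℚ) - 1 ≠ 0 := by push_cast; ring_nf; positivity
  have h2 : ((n + 2 : ℕ) : ℚ) ≠ 0 := by positivity
  field_simp
  push_cast
  ring

theorem card_triples (n : ℕ) : ((triples n).card : ℚ) = (n + 2) * (n + 1) / 2 := by
  have := sum_triples_fst n fun _ => 1
  simp only [Finset.sum_const, nsmul_eq_mul, mul_one] at this
  rw [this, Finset.sum_sub_distrib, Finset.sum_const, Finset.card_range, nsmul_eq_mul]
  have h : ∀ m : ℕ, ∑ k ∈ Finset.range m, (k : ℚ) = m * (m - 1) / 2 := by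
    intro m
    induction m with
    | zero => simp
    | succ m ih => rw [Finset.sum_range_succ, ih]; push_cast; ring
  rw [h]
  push_cast
  ring

/-- The recurrence of dual-pivot quicksort, as a sum over the class sizes. -/
theorem sum_triples_meanTotal (n : ℕ) :
    2 * ∑ t ∈ triples n, (1 + meanCost n t.1 t.2.1 t.2.2 + meanTotal t.1 + meanTotal t.2.1 +
      meanTotal t.2.2) = (n + 2) * (n + 1) * meanTotal (n + 2) := by
  -- Permuting coordinates shows that the three recursive terms have equal sums, which produces the
  -- factor 6 = 2 · 3.
  rw [meanTotal_add_two, ← sum_triples_fst]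
  have h1 := sum_triples_swap n fun s _ _ => meanTotal s
  have h2 := sum_triples_reverse n fun s _ _ => meanTotal s
  simp only [Finset.sum_add_distrib, Finset.sum_const, nsmul_eq_mul, mul_one] at h1 h2 ⊢
  rw [← h1, ← h2, card_triples, sumCost]
  ring

/-! ### The algorithm obeys the recurrence -/

section Quicksort

variable {α : Type*} [LinearOrder α]

theorem clairvoyant_cons_append (L : Layout) (a b : α) (rem : List α) :
    (clairvoyant L (a :: (rem ++ [b]))).2 =
      1 + (partition L (min a b) (max a b) rem).2 +
        (clairvoyant L (bucket L (partition L (min a b) (max a b) rem).1 Cls.small)).2 +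
        (clairvoyant L (bucket L (partition L (min a b) (max a b) rem).1 Cls.medium)).2 +
        (clairvoyant L (bucket L (partition L (min a b) (max a b) rem).1 Cls.large)).2 := by
  obtain ⟨x, xs, hx⟩ : ∃ x xs, rem ++ [b] = x :: xs :=
    List.exists_cons_of_ne_nil (by simp)
  have h1 : (x :: xs).getLast (List.cons_ne_nil x xs) = b := by
    simp only [← hx, List.getLast_append_singleton]
  have h2 : (x :: xs).dropLast = rem := by rw [← hx, List.dropLast_concat]
  rw [hx, clairvoyant]
  simp only [h1, h2]

theorem countP_of_mem_orders {R : Finset α} {l : List α} (h : l ∈ orders R) (P : α → Prop)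
    [DecidablePred P] : l.countP (fun x => P x) = (R.filter P).card := by
  rw [mem_orders] at h
  rw [List.countP_eq_length_filter, ← List.toFinset_card_of_nodup (h.1.filter _),
    List.toFinset_filter, h.2]
  simp

theorem partition_of_mem_orders {p q : α} (hpq : p < q) (L : Layout) {R : Finset α} (hq : q ∉ R)
    {rem : List α} (h : rem ∈ orders R) :
    partition L p q rem =
      classifyLoop L p q (clsCard p q R Cls.small) (clsCard p q R Cls.large) [] rem := by
  have hs : (R.filter fun x => x < p) = R.filter fun x => clsOf p q x = Cls.small := by
    ext x
    simp only [Finset.mem_filter]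
    unfold clsOf
    split_ifs <;> simp_all
  have hl : (R.filter fun x => q < x) = R.filter fun x => clsOf p q x = Cls.large := by
    ext x
    simp only [Finset.mem_filter, and_congr_right_iff]
    intro hx
    have hxq : x ≠ q := fun h => hq (h ▸ hx)
    unfold clsOf
    split_ifs with h1 h2
    · simpa using (h1.trans hpq).le
    · simpa using h2.le
    · simpa using lt_of_le_of_ne (not_lt.1 h2) hxq.symm
  unfold partition
  rw [countP_of_mem_orders h, countP_of_mem_orders h, hs, hl]
  rfl

theorem sum_clairvoyant (L : Layout) (n : ℕ) : ∀ A : Finset α, A.card = n →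
    ∑ l ∈ orders A, ((clairvoyant L l).2 : ℚ) = n.factorial * meanTotal n := by
  induction n using Nat.strong_induction_on with
  | _ n ih =>
  intro A hA
  rcases Nat.lt_or_ge n 2 with hn | hn
  · rw [meanTotal_of_lt_two hn, mul_zero]
    refine Finset.sum_eq_zero fun l hl => ?_
    have hlen := length_of_mem_orders hl
    match l, hlen with
    | [], _ => simp [clairvoyant]
    | [a], _ => simp [clairvoyant]
    | a :: b :: l, hlen => simp at hlen; omega
  obtain ⟨n, rfl⟩ : ∃ k, n = k + 2 := ⟨n - 2, by omega⟩
  -- For fixed pivots, linearity suffices: the joint distribution of the buckets is irrelevant,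
  -- since each class is treated on its own by `sum_bucket` and the induction hypothesis.
  have inner : ∀ p q : α, p < q → ∀ R : Finset α, p ∉ R → q ∉ R → R.card = n →
      ∑ rem ∈ orders R, ((1 + (partition L p q rem).2 +
        (clairvoyant L (bucket L (partition L p q rem).1 Cls.small)).2 +
        (clairvoyant L (bucket L (partition L p q rem).1 Cls.medium)).2 +
        (clairvoyant L (bucket L (partition L p q rem).1 Cls.large)).2 : ℕ) : ℚ) =
      n.factorial * (1 + meanCost n (clsCard p q R Cls.small) (clsCard p q R Cls.medium)
        (clsCard p q R Cls.large) + meanTotal (clsCard p q R Cls.small) +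
        meanTotal (clsCard p q R Cls.medium) + meanTotal (clsCard p q R Cls.large)) := by
    intro p q hpq R hp hq hR
    have hb : ∀ c, ∑ rem ∈ orders R,
        ((clairvoyant L (bucket L (partition L p q rem).1 c)).2 : ℚ) =
        n.factorial * meanTotal (clsCard p q R c) := by
      intro c
      have h1 := sum_bucket hpq L (clsCard p q R Cls.small) (clsCard p q R Cls.large) R hp hq c
        fun b => ((clairvoyant L b).2 : ℚ)
      have h2 : clsCard p q R c < n + 2 := by
        have := Finset.card_filter_le R fun x => clsOf p q x = c
        unfold clsCard
        omega
      rw [ih _ h2 (R.filter fun x => clsOf p q x = c) rfl, hR] at h1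
      have h3 : ((clsCard p q R c).factorial : ℚ) ≠ 0 := by positivity
      rw [Finset.sum_congr rfl fun rem hrem => by rw [partition_of_mem_orders hpq L hq hrem]]
      apply mul_left_cancel₀ h3
      rw [h1]
      ring
    have hl : ∑ rem ∈ orders R, ((partition L p q rem).2 : ℚ) = n.factorial *
        meanCost n (clsCard p q R Cls.small) (clsCard p q R Cls.medium)
          (clsCard p q R Cls.large) := by
      rw [Finset.sum_congr rfl fun rem hrem => by rw [partition_of_mem_orders hpq L hq hrem]]
      exact sum_classifyLoop hpq L _ _ n [] R hp hq hR (by simp) (by simp)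
    push_cast
    simp only [Finset.sum_add_distrib, hb, hl, Finset.sum_const, card_orders, hR, nsmul_eq_mul]
    ring
  -- Remove the entry at position 0, then the entry at position `n` of the remaining `n + 1`, that
  -- is, the last.
  have outer : ∑ l ∈ orders A, ((clairvoyant L l).2 : ℚ) =
      ∑ a ∈ A, ∑ b ∈ A.erase a, ∑ rem ∈ orders ((A.erase a).erase b),
        ((clairvoyant L (a :: (rem ++ [b]))).2 : ℚ) := by
    rw [sum_orders_insertIdx A (k := 0) (by omega)]
    refine Finset.sum_congr rfl fun a ha => ?_
    have hc : (A.erase a).card = n + 1 := by rw [Finset.card_erase_of_mem ha, hA]; rfl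
    rw [sum_orders_insertIdx (A.erase a) (k := n) (by omega)]
    refine Finset.sum_congr rfl fun b hb => Finset.sum_congr rfl fun rem hrem => ?_
    have hlen := length_of_mem_orders hrem
    rw [Finset.card_erase_of_mem hb, hc, Nat.add_sub_cancel] at hlen
    rw [List.insertIdx_zero, ← hlen, List.insertIdx_length_self]
  rw [outer]
  have step : ∀ a ∈ A, ∀ b ∈ A.erase a, ∑ rem ∈ orders ((A.erase a).erase b),
        ((clairvoyant L (a :: (rem ++ [b]))).2 : ℚ) = _ := fun a ha b hb => by
    have hab : b ≠ a := (Finset.mem_erase.1 hb).1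
    have hc : ((A.erase a).erase b).card = n := by
      rw [Finset.card_erase_of_mem hb, Finset.card_erase_of_mem ha, hA]; rfl
    have hR : ∀ x, x = a ∨ x = b → x ∉ (A.erase a).erase b := by
      rintro x (rfl | rfl) <;> simp
    exact (Finset.sum_congr rfl fun rem _ => by rw [clairvoyant_cons_append]).trans
      (inner (min a b) (max a b) (min_lt_max.2 hab.symm) ((A.erase a).erase b)
        (hR _ (min_choice a b)) (hR _ (max_choice a b)) hc)
  rw [Finset.sum_congr rfl fun a ha => Finset.sum_congr rfl (step a ha),
    sum_pivots n A hA fun s m l => n.factorial * (1 + meanCost n s m l + meanTotal s +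
      meanTotal m + meanTotal l), ← Finset.mul_sum, mul_left_comm, sum_triples_meanTotal,
    Nat.factorial_succ, Nat.factorial_succ]
  push_cast
  ring

theorem avgComparisons_eq (L : Layout) {n : ℕ} (a : Fin n → α) (ha : Function.Injective a) :
    avgComparisons L a = meanTotal n := by
  unfold avgComparisons
  rw [sum_perm_ofFn a ha fun l => ((clairvoyant L l).2 : ℚ), sum_clairvoyant L n _
    (by rw [Finset.card_image_of_injective _ ha, Finset.card_univ, Fintype.card_fin])]
  rw [mul_div_cancel_left₀]
  positivity

end Quicksort

/-! ### Closed form of the summed partitioning cost -/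

theorem sum_triples_shift_fst (N : ℕ) (F : ℕ → ℕ → ℕ → ℚ) :
    ∑ t ∈ triples (N + 1), (t.1 : ℚ) * F (t.1 - 1) t.2.1 t.2.2 =
      ∑ t ∈ triples N, ((t.1 : ℚ) + 1) * F t.1 t.2.1 t.2.2 := by
  -- Where the truncated `t.1 - 1` would be wrong, the factor `t.1` vanishes.
  rw [← Finset.sum_filter_of_ne (p := fun t : ℕ × ℕ × ℕ => t.1 ≠ 0)
    (by intro t _ h h'; exact h (by rw [h', Nat.cast_zero, zero_mul]))]
  refine Finset.sum_nbij' (fun t => (t.1 - 1, t.2.1, t.2.2)) (fun t => (t.1 + 1, t.2.1, t.2.2))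
    ?_ ?_ ?_ ?_ ?_
  · intro t ht
    rw [Finset.mem_filter, mem_triples] at ht
    rw [mem_triples]
    simp only
    omega
  · intro t ht
    rw [mem_triples] at ht
    rw [Finset.mem_filter, mem_triples]
    simp only
    omega
  · rintro ⟨s, m, l⟩ ht
    rw [Finset.mem_filter] at ht
    simp only [Prod.mk.injEq, and_true] at ht ⊢
    omega
  · rintro ⟨s, m, l⟩ _
    rfl
  · rintro ⟨s, m, l⟩ ht
    rw [Finset.mem_filter] at ht
    simp only at ht ⊢
    rw [Nat.cast_pred (by omega)]
    ring

theorem sum_triples_shift_snd (N : ℕ) (F : ℕ → ℕ → ℕ → ℚ) :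
    ∑ t ∈ triples (N + 1), (t.2.1 : ℚ) * F t.1 (t.2.1 - 1) t.2.2 =
      ∑ t ∈ triples N, ((t.2.1 : ℚ) + 1) * F t.1 t.2.1 t.2.2 := by
  rw [sum_triples_swap (N + 1) fun s m l => (m : ℚ) * F s (m - 1) l,
    sum_triples_swap N fun s m l => ((m : ℚ) + 1) * F s m l]
  exact sum_triples_shift_fst N fun s m l => F m s l

theorem sum_triples_shift_trd (N : ℕ) (F : ℕ → ℕ → ℕ → ℚ) :
    ∑ t ∈ triples (N + 1), (t.2.2 : ℚ) * F t.1 t.2.1 (t.2.2 - 1) =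
      ∑ t ∈ triples N, ((t.2.2 : ℚ) + 1) * F t.1 t.2.1 t.2.2 := by
  rw [sum_triples_reverse (N + 1) fun s m l => (l : ℚ) * F s m (l - 1),
    sum_triples_reverse N fun s m l => ((l : ℚ) + 1) * F s m l]
  exact sum_triples_shift_fst N fun s m l => F l m s

/-- A triple with sum `N + 2` has a zero at an end, where the minimum vanishes, or it comes from a
triple with sum `N` by adding one at each end. -/
theorem sum_triples_min_add_two (N : ℕ) : ∑ t ∈ triples (N + 2), min (t.1 : ℚ) t.2.2 =
    ∑ t ∈ triples N, (min (t.1 : ℚ) t.2.2 + 1) := by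
  rw [← Finset.sum_filter_of_ne (p := fun t : ℕ × ℕ × ℕ => t.1 ≠ 0 ∧ t.2.2 ≠ 0) (by
    intro t _ h
    contrapose! h
    by_cases h0 : t.1 = 0
    · rw [h0, Nat.cast_zero, min_eq_left (Nat.cast_nonneg _)]
    · rw [h h0, Nat.cast_zero, min_eq_right (Nat.cast_nonneg _)])]
  symm
  refine Finset.sum_nbij' (fun t => (t.1 + 1, t.2.1, t.2.2 + 1))
    (fun t => (t.1 - 1, t.2.1, t.2.2 - 1)) ?_ ?_ ?_ ?_ ?_
  · intro t ht
    rw [mem_triples] at ht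
    rw [Finset.mem_filter, mem_triples]
    simp only
    omega
  · intro t ht
    rw [Finset.mem_filter, mem_triples] at ht
    rw [mem_triples]
    simp only
    omega
  · rintro ⟨s, m, l⟩ _
    rfl
  · rintro ⟨s, m, l⟩ ht
    rw [Finset.mem_filter] at ht
    simp only [Prod.mk.injEq, true_and] at ht ⊢
    omega
  · intro t _
    push_cast
    exact (min_add_add_right _ _ _).symm

theorem sum_triples_min_even (k : ℕ) :
    ∑ t ∈ triples (2 * k), min (t.1 : ℚ) t.2.2 = (k : ℚ) * (k + 1) * (4 * k - 1) / 6 := by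
  induction k with
  | zero => decide +kernel
  | succ k ih =>
    rw [mul_add_one, sum_triples_min_add_two, Finset.sum_add_distrib, ih, Finset.sum_const,
      nsmul_eq_mul, card_triples]
    push_cast
    ring

theorem sum_triples_min_odd (k : ℕ) :
    ∑ t ∈ triples (2 * k + 1), min (t.1 : ℚ) t.2.2 = (k : ℚ) * (k + 1) * (4 * k + 5) / 6 := by
  induction k with
  | zero => decide +kernel
  | succ k ih =>
    rw [show 2 * (k + 1) + 1 = 2 * k + 1 + 2 by ring, sum_triples_min_add_two,
      Finset.sum_add_distrib, ih, Finset.sum_const, nsmul_eq_mul, card_triples]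
    push_cast
    ring

theorem sum_triples_snd (N : ℕ) :
    ∑ t ∈ triples N, (t.2.1 : ℚ) = (N : ℚ) * (N + 1) * (N + 2) / 6 := by
  have h1 := sum_triples_swap N fun s _ _ => (s : ℚ)
  have h2 := sum_triples_reverse N fun s _ _ => (s : ℚ)
  have h3 : ∑ t ∈ triples N, ((t.1 : ℚ) + t.2.1 + t.2.2) = ∑ t ∈ triples N, (N : ℚ) :=
    Finset.sum_congr rfl fun t ht => by rw [← mem_triples.1 ht]; push_cast; rfl
  simp only [Finset.sum_add_distrib, Finset.sum_const, nsmul_eq_mul, card_triples] at h1 h2 h3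
  linarith

/-- Drawing an element lowers one coordinate. Conversely, a triple with sum `N` is reached from its
three raised neighbours with weights `s + 1`, `m + 1`, `l + 1`, whose sum is `N + 3` for every
triple. Hence `meanCost` enters only through its total `sumCost N`. -/
theorem sumCost_succ (N : ℕ) : ((N : ℚ) + 1) * sumCost (N + 1) = (N + 3) * sumCost N +
    2 / 3 * (N + 1) * (N + 2) * (N + 3) + ∑ t ∈ triples (N + 1), min (t.1 : ℚ) t.2.2 := by
  have h1 := sum_triples_shift_fst N (meanCost N)
  have h2 := sum_triples_shift_snd N (meanCost N)
  have h3 := sum_triples_shift_trd N (meanCost N)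
  have h4 := sum_triples_snd (N + 1)
  have h5 : ∑ t ∈ triples (N + 1), ((t.1 : ℚ) + 2 * t.2.1 + t.2.2) =
      ∑ t ∈ triples (N + 1), ((N : ℚ) + 1 + t.2.1) := by
    refine Finset.sum_congr rfl fun t ht => ?_
    have : ((t.1 + t.2.1 + t.2.2 : ℕ) : ℚ) = (N + 1 : ℕ) := by rw [mem_triples.1 ht]
    push_cast at this
    linarith
  have h6 : ((N : ℚ) + 3) * sumCost N =
      ∑ t ∈ triples N, ((t.1 : ℚ) + 1) * meanCost N t.1 t.2.1 t.2.2 +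
      ∑ t ∈ triples N, ((t.2.1 : ℚ) + 1) * meanCost N t.1 t.2.1 t.2.2 +
      ∑ t ∈ triples N, ((t.2.2 : ℚ) + 1) * meanCost N t.1 t.2.1 t.2.2 := by
    rw [← Finset.sum_add_distrib, ← Finset.sum_add_distrib, sumCost, Finset.mul_sum]
    refine Finset.sum_congr rfl fun t ht => ?_
    rw [← mem_triples.1 ht]
    push_cast
    ring
  have h7 : ((N : ℚ) + 1) * sumCost (N + 1) =
      ∑ t ∈ triples (N + 1), ((t.1 : ℚ) + 2 * t.2.1 + t.2.2) +
      ∑ t ∈ triples (N + 1), min (t.1 : ℚ) t.2.2 +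
      ∑ t ∈ triples (N + 1), (t.1 : ℚ) * meanCost N (t.1 - 1) t.2.1 t.2.2 +
      ∑ t ∈ triples (N + 1), (t.2.1 : ℚ) * meanCost N t.1 (t.2.1 - 1) t.2.2 +
      ∑ t ∈ triples (N + 1), (t.2.2 : ℚ) * meanCost N t.1 t.2.1 (t.2.2 - 1) := by
    simp only [← Finset.sum_add_distrib]
    rw [sumCost, Finset.mul_sum]
    refine Finset.sum_congr rfl fun t _ => ?_
    have : (N : ℚ) + 1 ≠ 0 := by positivity
    rw [meanCost]
    field_simp
  rw [h7, h6, h1, h2, h3, h5, Finset.sum_add_distrib, h4, Finset.sum_const, nsmul_eq_mul,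
    card_triples]
  push_cast
  ring

theorem harmonicAlt_succ (n : ℕ) :
    harmonicAlt (n + 1) = harmonicAlt n + (-1) ^ (n + 1) / (n + 1) := by
  unfold harmonicAlt
  rw [Finset.sum_Icc_succ_top (by omega)]
  push_cast
  rfl

theorem harmonicAlt_succ_of_even {n : ℕ} (h : Even n) :
    harmonicAlt (n + 1) = harmonicAlt n - 1 / (n + 1) := by
  rw [harmonicAlt_succ, h.add_one.neg_one_pow]
  ring

theorem harmonicAlt_succ_of_odd {n : ℕ} (h : Odd n) :
    harmonicAlt (n + 1) = harmonicAlt n + 1 / (n + 1) := by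
  rw [harmonicAlt_succ, h.add_one.neg_one_pow]

theorem harmonic_succ_eq (n : ℕ) : harmonic (n + 1) = harmonic n + 1 / (n + 1) := by
  rw [harmonic_succ, one_div]
  push_cast
  rfl

/-- Division by `(N + 1) * (N + 2) * (N + 3)` makes `sumCost_succ` telescope. The increments then
have only odd linear denominators, so their sum involves `harmonic - harmonicAlt`, twice the sum of
the reciprocals of odd numbers. -/
theorem sumCost_odd_of_even (k : ℕ) (h : 2 * sumCost (2 * k) = (2 * k + 2) * (2 * k + 1) *
      (3 * k + 3 / 8 - (harmonic (2 * k + 2) - harmonicAlt (2 * k + 2)) / 4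
        + 1 / (8 * (2 * k + 1)))) :
    2 * sumCost (2 * k + 1) = (2 * k + 3) * (2 * k + 2) *
      (3 * k + 15 / 8 - (harmonic (2 * k + 3) - harmonicAlt (2 * k + 3)) / 4
        + 3 / (8 * (2 * k + 3))) := by
  have h1 := sumCost_succ (2 * k)
  rw [sum_triples_min_odd] at h1
  rw [harmonic_succ_eq (2 * k + 2), harmonicAlt_succ_of_even (n := 2 * k + 2) (by simp [parity_simps])]
  generalize harmonic (2 * k + 2) = x at *
  generalize harmonicAlt (2 * k + 2) = y at *
  have h2 : (2 * (k : ℚ) + 1) ≠ 0 := by positivity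
  have h3 : (2 * (k : ℚ) + 3) ≠ 0 := by positivity
  push_cast at *
  apply mul_left_cancel₀ h2
  -- Arranged so that `2 * sumCost (2 * k)`, the left side of `h`, occurs literally.
  have h4 : (2 * (k : ℚ) + 1) * (2 * sumCost (2 * k + 1)) = (2 * k + 3) * (2 * sumCost (2 * k)) +
    2 * (2 / 3 * (2 * k + 1) * (2 * k + 2) * (2 * k + 3) + k * (k + 1) * (4 * k + 5) / 6) := by
    linear_combination 2 * h1
  rw [h4, h]
  have h5 : (2 * (k : ℚ) + 2 + 1) ≠ 0 := by positivity
  field_simp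
  ring

theorem sumCost_even_of_odd (k : ℕ) (h : 2 * sumCost (2 * k + 1) = (2 * k + 3) * (2 * k + 2) *
      (3 * k + 15 / 8 - (harmonic (2 * k + 3) - harmonicAlt (2 * k + 3)) / 4
        + 3 / (8 * (2 * k + 3)))) :
    2 * sumCost (2 * k + 2) = (2 * k + 4) * (2 * k + 3) *
      (3 * k + 27 / 8 - (harmonic (2 * k + 4) - harmonicAlt (2 * k + 4)) / 4
        + 1 / (8 * (2 * k + 3))) := by
  have h1 := sumCost_succ (2 * k + 1)
  rw [show 2 * k + 1 + 1 = 2 * (k + 1) by ring, sum_triples_min_even] at h1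
  rw [harmonic_succ_eq (2 * k + 3), harmonicAlt_succ_of_odd (n := 2 * k + 3) (by simp [parity_simps])]
  rw [show 2 * k + 2 = 2 * (k + 1) by ring]
  generalize harmonic (2 * k + 3) = x at *
  generalize harmonicAlt (2 * k + 3) = y at *
  have h2 : (2 * (k : ℚ) + 2) ≠ 0 := by positivity
  have h3 : (2 * (k : ℚ) + 3) ≠ 0 := by positivity
  push_cast at *
  apply mul_left_cancel₀ h2
  have h4 : (2 * (k : ℚ) + 2) * (2 * sumCost (2 * (k + 1))) =
    (2 * k + 4) * (2 * sumCost (2 * k + 1)) + 2 * (2 / 3 * (2 * k + 2) * (2 * k + 3) * (2 * k + 4) +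
      (k + 1) * (k + 2) * (4 * k + 3) / 6) := by
    linear_combination 2 * h1
  rw [h4, h]
  have h5 : (2 * (k : ℚ) + 3 + 1) ≠ 0 := by positivity
  field_simp
  ring

theorem two_mul_sumCost_even (k : ℕ) : 2 * sumCost (2 * k) = (2 * k + 2) * (2 * k + 1) *
    (3 * k + 3 / 8 - (harmonic (2 * k + 2) - harmonicAlt (2 * k + 2)) / 4
      + 1 / (8 * (2 * k + 1))) := by
  induction k with
  | zero =>
    have h : sumCost 0 = 0 := Finset.sum_eq_zero fun _ _ => rfl
    rw [mul_zero, h, zero_add, harmonic_succ_eq 1, harmonicAlt_succ_of_odd odd_one,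
      harmonic_succ_eq 0]
    norm_num [harmonicAlt]
  | succ k ih =>
    have h := sumCost_even_of_odd k (sumCost_odd_of_even k ih)
    rw [show 2 * (k + 1) = 2 * k + 2 by ring, h]
    push_cast
    ring

theorem two_mul_sumCost_odd (k : ℕ) : 2 * sumCost (2 * k + 1) = (2 * k + 3) * (2 * k + 2) *
    (3 * k + 15 / 8 - (harmonic (2 * k + 3) - harmonicAlt (2 * k + 3)) / 4
      + 3 / (8 * (2 * k + 3))) :=
  sumCost_odd_of_even k (two_mul_sumCost_even k)

/-! ### Solving the quicksort recurrence -/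

theorem meanTotal_recurrence (n : ℕ) :
    ((n : ℚ) + 4) * (n + 3) * meanTotal (n + 4) = 2 * (n + 3) * (n + 2) * meanTotal (n + 3) -
      (n + 2) * (n + 1) * meanTotal (n + 2) + 6 * meanTotal (n + 2) + 2 +
      2 * sumCost (n + 2) - 2 * (2 * sumCost (n + 1)) + 2 * sumCost n := by
  have h0 := meanTotal_add_two n
  have h1 := meanTotal_add_two (n + 1)
  have h2 := meanTotal_add_two (n + 2)
  -- First difference of the weighted sum: every weight grows by 1. The second difference is the
  -- single term `meanTotal (m + 2)`.
  have e : ∀ m : ℕ, ∑ k ∈ Finset.range (m + 2), (((m + 1 : ℕ) : ℚ) + 1 - k) * meanTotal k =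
      ∑ k ∈ Finset.range (m + 1), ((m : ℚ) + 1 - k) * meanTotal k +
        ∑ k ∈ Finset.range (m + 2), meanTotal k := by
    intro m
    rw [Finset.sum_range_succ, Finset.sum_range_succ _ (m + 1), ← add_assoc,
      ← Finset.sum_add_distrib]
    push_cast
    congr 1
    · exact Finset.sum_congr rfl fun k _ => by ring
    · ring
  rw [e n] at h1
  rw [e (n + 1), e n, Finset.sum_range_succ _ (n + 2)] at h2
  push_cast at h0 h1 h2
  -- The constant 2 is the second difference of `(n + 2) * (n + 1)`.
  linear_combination h2 - 2 * h1 + h0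

/-- The two initial values for the order-two recurrence, obtained by unrolling the full recurrence
from `meanTotal 0 = meanTotal 1 = 0`. -/
theorem meanTotal_four : meanTotal 4 = 17 / 4 ∧ meanTotal 5 = 389 / 60 := by
  have h0 := meanTotal_add_two 0
  have h1 := meanTotal_add_two 1
  have h2 := meanTotal_add_two 2
  have h3 := meanTotal_add_two 3
  have e0 := two_mul_sumCost_even 0
  have e1 := two_mul_sumCost_odd 0
  have e2 := two_mul_sumCost_even 1
  have e3 := two_mul_sumCost_odd 1
  have z0 := meanTotal_of_lt_two (n := 0) (by norm_num)
  have z1 := meanTotal_of_lt_two (n := 1) (by norm_num)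
  norm_num [Finset.sum_range_succ, harmonic, harmonicAlt, Finset.sum_Icc_succ_top, z0, z1]
    at h0 h1 h2 h3 e0 e1 e2 e3
  constructor <;> linarith

/-- The closed form of `meanTotal` on even and odd arguments. -/
theorem meanTotal_even_odd (k : ℕ) :
    meanTotal (2 * k + 4) = 9 / 5 * (2 * k + 4) * harmonic (2 * k + 4)
        + 1 / 5 * (2 * k + 4) * harmonicAlt (2 * k + 4) - 89 / 25 * (2 * k + 4)
        + 77 / 40 * harmonic (2 * k + 4) + 3 / 40 * harmonicAlt (2 * k + 4) + 67 / 800 - 1 / 10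
        + 1 / 320 * (1 / (2 * k + 1) + 3 / (2 * k + 3)) ∧
    meanTotal (2 * k + 5) = 9 / 5 * (2 * k + 5) * harmonic (2 * k + 5)
        + 1 / 5 * (2 * k + 5) * harmonicAlt (2 * k + 5) - 89 / 25 * (2 * k + 5)
        + 77 / 40 * harmonic (2 * k + 5) + 3 / 40 * harmonicAlt (2 * k + 5) + 67 / 800 + 1 / 10
        - 1 / 320 * (3 / (2 * k + 3) + 1 / (2 * k + 5)) := by
  induction k with
  | zero =>
    obtain ⟨h4, h5⟩ := meanTotal_four
    rw [mul_zero, zero_add, zero_add, h4, h5]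
    norm_num [Finset.sum_range_succ, harmonic, harmonicAlt, Finset.sum_Icc_succ_top]
  | succ k ih =>
    have r1 := meanTotal_recurrence (2 * k + 2)
    have r2 := meanTotal_recurrence (2 * k + 3)
    have c2 := two_mul_sumCost_even (k + 1)
    have c3 := two_mul_sumCost_odd (k + 1)
    have c4 := two_mul_sumCost_even (k + 2)
    have c5 := two_mul_sumCost_odd (k + 2)
    rw [show 2 * (k + 1) = 2 * k + 2 by ring] at c2 c3
    rw [show 2 * (k + 2) = 2 * k + 4 by ring] at c4 c5
    rw [show 2 * (k + 1) = 2 * k + 2 by ring]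
    simp only [add_assoc, Nat.reduceAdd] at r1 r2 c2 c3 c4 c5 ih ⊢
    have a5 := harmonicAlt_succ_of_even (n := 2 * k + 4) (by simp [parity_simps])
    have a6 := harmonicAlt_succ_of_odd (n := 2 * k + 5) (by simp [parity_simps])
    have a7 := harmonicAlt_succ_of_even (n := 2 * k + 6) (by simp [parity_simps])
    have b5 := harmonic_succ_eq (2 * k + 4)
    have b6 := harmonic_succ_eq (2 * k + 5)
    have b7 := harmonic_succ_eq (2 * k + 6)
    simp only [add_assoc, Nat.reduceAdd] at a5 a6 a7 b5 b6 b7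
    obtain ⟨ih4, ih5⟩ := ih
    push_cast at r1 r2 c2 c3 c4 c5 a5 a6 a7 b5 b6 b7 ih4 ih5 ⊢
    -- With the special values as symbols, the claims become identities of rational functions: after
    -- rewriting, only `x4`, `y4` and `q` remain.
    generalize harmonic (2 * k + 4) = x4 at *
    generalize harmonic (2 * k + 5) = x5 at *
    generalize harmonic (2 * k + 6) = x6 at *
    generalize harmonic (2 * k + 7) = x7 at *
    generalize harmonicAlt (2 * k + 4) = y4 at *
    generalize harmonicAlt (2 * k + 5) = y5 at *
    generalize harmonicAlt (2 * k + 6) = y6 at *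
    generalize harmonicAlt (2 * k + 7) = y7 at *
    generalize sumCost (2 * k + 2) = s2 at *
    generalize sumCost (2 * k + 3) = s3 at *
    generalize sumCost (2 * k + 4) = s4 at *
    generalize sumCost (2 * k + 5) = s5 at *
    generalize meanTotal (2 * k + 4) = z4 at *
    generalize meanTotal (2 * k + 5) = z5 at *
    generalize meanTotal (2 * k + 6) = z6 at *
    generalize meanTotal (2 * k + 7) = z7 at *
    have d1 : 2 * (k : ℚ) + 1 ≠ 0 := by positivity
    have d3 : 2 * (k : ℚ) + 3 ≠ 0 := by positivity
    have d5 : 2 * (k : ℚ) + 5 ≠ 0 := by positivity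
    have d6 : 2 * (k : ℚ) + 6 ≠ 0 := by positivity
    have d7 : 2 * (k : ℚ) + 7 ≠ 0 := by positivity
    generalize (k : ℚ) = q at *
    -- Each denominator is brought to the form `2 * q + c` in which `d1` to `d7` state that it is
    -- nonzero.
    have n3 : 2 * (q + 1) + 1 = 2 * q + 3 := by ring
    have n5 : 2 * (q + 1) + 3 = 2 * q + 5 := by ring
    have n5' : 2 * (q + 2) + 1 = 2 * q + 5 := by ring
    have n7 : 2 * (q + 2) + 3 = 2 * q + 7 := by ring
    have n7' : 2 * (q + 1) + 5 = 2 * q + 7 := by ring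
    have m5 : 2 * q + 4 + 1 = 2 * q + 5 := by ring
    have m6 : 2 * q + 5 + 1 = 2 * q + 6 := by ring
    have m7 : 2 * q + 6 + 1 = 2 * q + 7 := by ring
    rw [m5] at a5 b5
    rw [m6] at a6 b6
    rw [m7] at a7 b7
    rw [n3] at c2
    rw [n5] at c3
    rw [n5'] at c4
    rw [n7] at c5
    rw [n3, n5, n7']
    have g6 : z6 = 9 / 5 * (2 * (q + 1) + 4) * x6 + 1 / 5 * (2 * (q + 1) + 4) * y6 -
              89 / 25 * (2 * (q + 1) + 4) +
            (77 / 40 * x6 + (3 / 40 * y6 + 67 / 800)) -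
          1 / 10 +
        1 / 320 * (1 / (2 * q + 3) + 3 / (2 * q + 5)) := by
      -- This is the leading coefficient of the recurrence for `z6`.
      apply mul_left_cancel₀ (mul_ne_zero d6 d5)
      have r : (2 * q + 6) * (2 * q + 5) * z6 = 2 * (2 * q + 5) * (2 * q + 4) * z5
        - (2 * q + 4) * (2 * q + 3) * z4 + (6 * z4 + (2 + 2 * s4)) - 2 * (2 * s3) + 2 * s2 := by
        linear_combination r1
      rw [r, c2, c3, c4, ih4, ih5, a6, b6, a5, b5]
      clear * - d1 d3 d5 d6 d7
      field_simp
      ring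
    refine ⟨g6, ?_⟩
    apply mul_left_cancel₀ (mul_ne_zero d7 d6)
    have r : (2 * q + 7) * (2 * q + 6) * z7 = 2 * (2 * q + 6) * (2 * q + 5) * z6
      - (2 * q + 5) * (2 * q + 4) * z5 + (6 * z5 + (2 + 2 * s5)) - 2 * (2 * s4) + 2 * s3 := by
      linear_combination r2
    rw [r, c3, c4, c5, g6, ih5, a7, b7, a6, b6, a5, b5]
    clear * - d1 d3 d5 d6 d7
    field_simp
    ring

end DualPivot

theorem theorem22 (L : DualPivot.Layout) {α : Type*} [LinearOrder α] (n : ℕ) (hn : 4 ≤ n)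
    (a : Fin n → α) (ha : Function.Injective a) :
    DualPivot.avgComparisons L a =
      9 / 5 * n * harmonic n + 1 / 5 * n * DualPivot.harmonicAlt n - 89 / 25 * n
        + 77 / 40 * harmonic n + 3 / 40 * DualPivot.harmonicAlt n + 67 / 800 - (-1) ^ n / 10
        + (if Even n then 1 else 0) / 320 * (1 / ((n : ℚ) - 3) + 3 / ((n : ℚ) - 1))
        - (if Odd n then 1 else 0) / 320 * (3 / ((n : ℚ) - 2) + 1 / (n : ℚ)) := by
  rw [DualPivot.avgComparisons_eq L a ha]
  rcases Nat.even_or_odd n with h | h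
  · obtain ⟨k, rfl⟩ : ∃ k, n = 2 * k + 4 := by
      obtain ⟨m, rfl⟩ := h
      exact ⟨m - 2, by omega⟩
    rw [(DualPivot.meanTotal_even_odd k).1, if_pos h, if_neg (Nat.not_odd_iff_even.2 h),
      h.neg_one_pow]
    push_cast
    ring
  · obtain ⟨k, rfl⟩ : ∃ k, n = 2 * k + 5 := by
      obtain ⟨m, rfl⟩ := h
      exact ⟨m - 2, by omega⟩
    rw [(DualPivot.meanTotal_even_odd k).2, if_pos h, if_neg (Nat.not_even_iff_odd.2 h),
      h.neg_one_pow]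
    push_cast
    ring
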